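/- All graphs are finite, undirected and simple. A path decomposition of a graph $F$ is a collection of pairwise edge-disjoint paths of $F$ that together cover all the edges of $F$; let $p(F)$ denote the minimum number of paths in a path decomposition of $F$. The Cartesian product $G\Box H$ is the graph with vertex set $V(G)\times V(H)$ in which $(u_1,v_1)$ and $(u_2,v_2)$ are adjacent if and only if either $u_1u_2\in E(G)$ and $v_1=v_2$, or $v_1v_2\in E(H)$ and $u_1=u_2$. Let $G$ be a connected graph of order $m\ge 2$ in which every vertex has odd degree, and let $H$ be a connected graph of order $n$. Then $p(G\Box H)\le \frac{mn}{2}$. -/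

import Mathlib

namespace SimpleGraph

/-- A subgraph of `G` is a path if it is the subgraph traced by some walk without repeated
vertices. -/
def Subgraph.IsPathSubgraph {V : Type*} {G : SimpleGraph V} (P : G.Subgraph) : Prop :=
  ∃ (u v : V) (w : G.Walk u v), w.IsPath ∧ P = w.toSubgraph

/-- A path decomposition of `G`: a finite collection of paths of `G` that are pairwise
edge-disjoint and together cover all the edges of `G`. -/
structure IsPathDecomposition {V : Type*} (G : SimpleGraph V) (D : Finset G.Subgraph) : Prop where
  isPath : ∀ P ∈ D, P.IsPathSubgraph
  edgeDisjoint : ∀ P ∈ D, ∀ Q ∈ D, P ≠ Q → Disjoint P.edgeSet Q.edgeSet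
  covers : ∀ e ∈ G.edgeSet, ∃ P ∈ D, e ∈ P.edgeSet

/-- `p(G)`: the minimum number of paths in a path decomposition of `G`. For a finite graph the
minimum is over a nonempty set, by `exists_isPathDecomposition` below. -/
noncomputable def pathNumber {V : Type*} (G : SimpleGraph V) : ℕ :=
  sInf {k : ℕ | ∃ D : Finset G.Subgraph, G.IsPathDecomposition D ∧ D.card = k}

/-- Every finite graph has a path decomposition (take its single edges). -/
theorem exists_isPathDecomposition {V : Type*} [Finite V] (G : SimpleGraph V) :
    ∃ D : Finset G.Subgraph, G.IsPathDecomposition D := by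
  classical
  have hfin : {P : G.Subgraph | ∃ (u v : V) (h : G.Adj u v), P = G.subgraphOfAdj h}.Finite :=
    Set.toFinite _
  refine ⟨hfin.toFinset, ?_, ?_, ?_⟩
  · intro P hP
    obtain ⟨u, v, h, rfl⟩ := hfin.mem_toFinset.1 hP
    refine ⟨u, v, h.toWalk, ?_, ?_⟩
    · simp [h.ne]
    · simp
  · intro P hP Q hQ hne
    obtain ⟨u, v, h, rfl⟩ := hfin.mem_toFinset.1 hP
    obtain ⟨x, y, h', rfl⟩ := hfin.mem_toFinset.1 hQ
    rw [Set.disjoint_left]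
    intro e he he'
    simp only [edgeSet_subgraphOfAdj, Set.mem_singleton_iff] at he he'
    apply hne
    rw [he, Sym2.eq_iff] at he'
    rcases he' with ⟨rfl, rfl⟩ | ⟨rfl, rfl⟩
    · rfl
    · exact (subgraphOfAdj_symm h').symm ▸ rfl
  · intro e
    induction e using Sym2.ind with
    | _ u v =>
      intro he
      have h : G.Adj u v := (mem_edgeSet G).1 he
      exact ⟨G.subgraphOfAdj h, hfin.mem_toFinset.2 ⟨u, v, h, rfl⟩, by simp⟩

end SimpleGraph

/-!
Every set of edges of a graph on a finite vertex set decomposes into paths, trivial ones allowed,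
such that each vertex is an end of a path once or twice. This goes by induction on the number of
edges, together with the variant in which one prescribed vertex is one end short: given a
decomposition of the edges other than `s(a, x)` with `a` one end short, the edge is inserted at a
path end `x`. If that path meets `a`, entering it through `y`, then trading `s(a, y)` for
`s(a, x)` leaves a path that ends at `y` instead of `x`, and the insertion continues with
`s(a, y)`; each neighbour of `a` is used at most once. In the end `a` has gained an end and `x` has
lost one.

In `G` all degrees are odd, so by parity each vertex is an end exactly once, which gives `m / 2`
paths. In `H`, since each path has two ends and each vertex is an end at most twice, Hall's
theorem assigns distinct ends to the paths, i.e. there is a decomposition of `H` with one path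
`R v` starting at each vertex `v`. Prolonging the copy of a path `P` of `G` in the layer of `v` by
the copies of `R v` at its two ends gives `(m / 2) * n` paths in all, and each copy of `R v`
occurs once since each vertex of `G` is an end of exactly one `P`.
-/

open SimpleGraph

section Walks

variable {V : Type*} {G : SimpleGraph V} {u v w x y a b : V}

lemma isPath_append {p : G.Walk u v} {q : G.Walk v w} (hp : p.IsPath) (hq : q.IsPath)
    (h : ∀ z ∈ p.support, z ∈ q.support → z = v) : (p.append q).IsPath := by
  have hq' := hq.support_nodup
  rw [← q.cons_tail_support, List.nodup_cons] at hq'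
  rw [Walk.isPath_def, Walk.support_append, List.nodup_append']
  refine ⟨hp.support_nodup, hq'.2, fun z hzp hzq => hq'.1 ?_⟩
  exact h z hzp (List.mem_of_mem_tail hzq) ▸ hzq

lemma isPath_append_cons_iff {l : G.Walk x y} {h : G.Adj y a} {r : G.Walk a b} :
    (l.append (.cons h r)).IsPath ↔ (l.support ++ r.support).Nodup := by
  simp [Walk.isPath_def, Walk.support_append]

lemma isPath_reverse_append_cons {l : G.Walk x y} {hya : G.Adj y a} {r : G.Walk a b}
    (h : (l.append (.cons hya r)).IsPath) (hxa : G.Adj x a) :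
    (l.reverse.append (.cons hxa r)).IsPath := by
  rw [isPath_append_cons_iff] at h ⊢
  rw [Walk.support_reverse]
  exact ((List.reverse_perm _).append_right _).nodup_iff.2 h

variable [DecidableEq V]

lemma mk_penultimate_takeUntil_mem_edges {p : G.Walk x b} (ha : a ∈ p.support) (hne : x ≠ a) :
    s(a, (p.takeUntil a ha).penultimate) ∈ p.edges := by
  rw [Sym2.eq_swap]
  exact p.edges_takeUntil_subset_edges ha
    (Walk.mk_penultimate_end_mem_edges (Walk.not_nil_of_ne hne))

lemma exists_eq_append_cons_of_mem_support {p : G.Walk x b} (ha : a ∈ p.support) (hne : x ≠ a) :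
    ∃ (y : V) (l : G.Walk x y) (h : G.Adj y a) (r : G.Walk a b),
      p = l.append (.cons h r) ∧ (p.takeUntil a ha).penultimate = y := by
  refine ⟨_, (p.takeUntil a ha).dropLast, Walk.adj_penultimate (Walk.not_nil_of_ne hne),
    p.dropUntil a ha, ?_, rfl⟩
  rw [← Walk.concat_append, Walk.concat_dropLast, Walk.take_spec]

end Walks

/-- A path of `G` together with its two ends, possibly trivial. -/
structure BundledPath {V : Type*} (G : SimpleGraph V) where
  fst : V
  snd : V
  walk : G.Walk fst snd
  isPath : walk.IsPath

namespace BundledPath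

variable {V : Type*} {G : SimpleGraph V} {a b x v : V}

/-- The edges of a path, as a multiset so that the edges of a family of paths can be added up. -/
def edges (P : BundledPath G) : Multiset (Sym2 V) := P.walk.edges

/-- The two ends of a path; a trivial path counts its vertex twice. -/
def ends (P : BundledPath G) : Multiset V := {P.fst, P.snd}

/-- The same path traversed from `P.snd` to `P.fst`. -/
def reverse (P : BundledPath G) : BundledPath G := ⟨P.snd, P.fst, P.walk.reverse, P.isPath.reverse⟩

@[simp] lemma mem_ends {P : BundledPath G} : v ∈ P.ends ↔ v = P.fst ∨ v = P.snd := by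
  simp [ends]

@[simp] lemma reverse_reverse (P : BundledPath G) : P.reverse.reverse = P := by
  simp [reverse]

@[simp] lemma edges_reverse (P : BundledPath G) : P.reverse.edges = P.edges := by
  simp [edges, reverse]

@[simp] lemma ends_reverse (P : BundledPath G) : P.reverse.ends = P.ends :=
  Multiset.pair_comm _ _

/-- Membership in a family of paths, disregarding the direction in which a path is traversed. -/
def MemUpToReverse (P : BundledPath G) (M : Multiset (BundledPath G)) : Prop :=
  P ∈ M ∨ P.reverse ∈ M

lemma memUpToReverse_cons {P Q : BundledPath G} {M : Multiset (BundledPath G)} :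
    MemUpToReverse P (Q ::ₘ M) ↔ P = Q ∨ P = Q.reverse ∨ MemUpToReverse P M := by
  have : P.reverse = Q ↔ P = Q.reverse :=
    ⟨fun h => by rw [← h, reverse_reverse], fun h => by rw [h, reverse_reverse]⟩
  simp only [MemUpToReverse, Multiset.mem_cons, this]
  tauto

lemma exists_memUpToReverse {M : Multiset (BundledPath G)} (hv : v ∈ M.bind ends) :
    ∃ P : BundledPath G, MemUpToReverse P M ∧ P.fst = v := by
  obtain ⟨P, hP, hvP⟩ := Multiset.mem_bind.1 hv
  rcases mem_ends.1 hvP with rfl | rfl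
  · exact ⟨P, .inl hP, rfl⟩
  · exact ⟨P.reverse, .inr (by rwa [reverse_reverse]), rfl⟩

lemma MemUpToReverse.edges_le {P : BundledPath G} {M : Multiset (BundledPath G)}
    (h : MemUpToReverse P M) : P.edges ≤ M.bind edges := by
  rcases h with h | h
  · exact Multiset.le_bind M h
  · exact P.edges_reverse ▸ Multiset.le_bind M h

lemma MemUpToReverse.exists_cons {P : BundledPath G} {M : Multiset (BundledPath G)}
    (h : MemUpToReverse P M) : ∃ N, M.bind edges = (P ::ₘ N).bind edges ∧
      M.bind ends = (P ::ₘ N).bind ends ∧ ∀ Q, MemUpToReverse Q M ↔ MemUpToReverse Q (P ::ₘ N) := by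
  rcases h with h | h <;> obtain ⟨N, rfl⟩ := Multiset.exists_cons_of_mem h
  · exact ⟨N, rfl, rfl, fun _ => .rfl⟩
  · refine ⟨N, by simp, by simp, fun Q => ?_⟩
    rw [memUpToReverse_cons, memUpToReverse_cons, reverse_reverse]
    tauto

lemma exists_insert_edge_of_notMem_support {P : BundledPath G} {M : Multiset (BundledPath G)}
    (hP : P.MemUpToReverse M) (hadj : G.Adj a P.fst) (ha : a ∉ P.walk.support) :
    ∃ M' : Multiset (BundledPath G), M'.bind edges = s(a, P.fst) ::ₘ M.bind edges ∧
      P.fst ::ₘ M'.bind ends = a ::ₘ M.bind ends := by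
  obtain ⟨N, hedges, hends, -⟩ := hP.exists_cons
  refine ⟨⟨a, P.snd, .cons hadj P.walk, P.isPath.cons ha⟩ ::ₘ N, ?_, ?_⟩
  · rw [hedges, Multiset.cons_bind, Multiset.cons_bind, ← Multiset.cons_add]
    rfl
  · rw [hends, Multiset.cons_bind, Multiset.cons_bind]
    simp only [ends, Multiset.insert_eq_cons, Multiset.cons_add]
    rw [Multiset.cons_swap]

section Exchange

variable [DecidableEq V]

/-- Some path of `M` ends at `v` and, when followed from there, either misses `a` or enters `a`
through a vertex of `D`. -/
def HasEnd (M : Multiset (BundledPath G)) (a : V) (D : Finset V) (v : V) : Prop :=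
  ∃ P : BundledPath G, MemUpToReverse P M ∧ P.fst = v ∧
    ∀ ha : a ∈ P.walk.support, (P.walk.takeUntil a ha).penultimate ∈ D

lemma MemUpToReverse.penultimate_takeUntil_ne {P : BundledPath G} {M : Multiset (BundledPath G)}
    (hP : P.MemUpToReverse M) (hne : a ≠ x) (hx : s(a, x) ∉ M.bind edges)
    (ha : a ∈ P.walk.support) : (P.walk.takeUntil a ha).penultimate ≠ x := by
  rintro rfl
  refine hx (Multiset.mem_of_le hP.edges_le ?_)
  refine mk_penultimate_takeUntil_mem_edges ha fun h => hne ?_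
  obtain ⟨u, v, p, hp⟩ := P
  obtain rfl : u = a := h
  simp

lemma HasEnd.reverse_append_cons {y : V} {l : G.Walk x y} {hya : G.Adj y a} {r : G.Walk a b}
    {hl : (l.append (.cons hya r)).IsPath} {hxa : G.Adj x a}
    {hl' : (l.reverse.append (.cons hxa r)).IsPath} {N : Multiset (BundledPath G)} {D : Finset V}
    (hx : s(a, x) ∉ (⟨x, b, _, hl⟩ ::ₘ N : Multiset (BundledPath G)).bind edges) (hvx : v ≠ x)
    (hv : HasEnd (⟨x, b, _, hl⟩ ::ₘ N) a D v) :
    HasEnd (⟨y, b, _, hl'⟩ ::ₘ N) a (D.erase x) v := by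
  obtain ⟨P, hP, rfl, hD⟩ := hv
  replace hD ha := Finset.mem_erase.2 ⟨hP.penultimate_takeUntil_ne hxa.ne' hx ha, hD ha⟩
  rcases memUpToReverse_cons.1 hP with rfl | rfl | hPN
  · exact absurd rfl hvx
  · refine ⟨reverse ⟨y, b, _, hl'⟩, memUpToReverse_cons.2 (.inr (.inl rfl)), rfl, fun ha => ?_⟩
    convert hD (by simp [reverse]) using 1
    simp [reverse, Walk.reverse_append, Walk.takeUntil_append_of_mem_left]
  · exact ⟨P, memUpToReverse_cons.2 (.inr (.inr hPN)), rfl, hD⟩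

lemma exists_rotation {y : V} {l : G.Walk x y} {hya : G.Adj y a} {r : G.Walk a b}
    {hl : (l.append (.cons hya r)).IsPath} {M : Multiset (BundledPath G)}
    (hP : MemUpToReverse ⟨x, b, _, hl⟩ M) (hxa : G.Adj x a) (hx : s(a, x) ∉ M.bind edges) :
    ∃ M' : Multiset (BundledPath G), s(a, y) ::ₘ M'.bind edges = s(a, x) ::ₘ M.bind edges ∧
      x ::ₘ M'.bind ends = y ::ₘ M.bind ends ∧
      ∀ D v, v ≠ x → HasEnd M a D v → HasEnd M' a (D.erase x) v := by
  obtain ⟨N, hedges, hends, hmem⟩ := hP.exists_cons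
  refine ⟨⟨y, b, _, isPath_reverse_append_cons hl hxa⟩ ::ₘ N, ?_, ?_, fun D v hvx hv => ?_⟩
  · rw [hedges, Multiset.cons_bind, Multiset.cons_bind, ← Multiset.cons_add, ← Multiset.cons_add]
    congr 1
    simp only [edges, Walk.edges_append, Walk.edges_cons, Walk.edges_reverse,
      ← Multiset.coe_add, ← Multiset.cons_coe, Multiset.coe_reverse, Multiset.add_cons,
      Sym2.eq_swap (a := a)]
    exact Multiset.cons_swap ..
  · rw [hends, Multiset.cons_bind, Multiset.cons_bind]
    simp only [ends, Multiset.insert_eq_cons, Multiset.cons_add]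
    exact Multiset.cons_swap ..
  · refine HasEnd.reverse_append_cons (hl := hl) (hedges ▸ hx) hvx ?_
    obtain ⟨P, hPM, hPD⟩ := hv
    exact ⟨P, (hmem P).1 hPM, hPD⟩

lemma exists_insert_edge_of_hasEnd {D : Finset V} {M : Multiset (BundledPath G)} (hxD : x ∈ D)
    (hadj : G.Adj a x) (hM : (s(a, x) ::ₘ M.bind edges).Nodup) (hD : ∀ v ∈ D, HasEnd M a D v) :
    ∃ M' : Multiset (BundledPath G), M'.bind edges = s(a, x) ::ₘ M.bind edges ∧
      x ::ₘ M'.bind ends = a ::ₘ M.bind ends := by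
  induction D using Finset.strongInduction generalizing x M with
  | H D ih =>
    have hx := (Multiset.nodup_cons.1 hM).1
    obtain ⟨⟨x, b, p, hp⟩, hP, rfl, hPD⟩ := hD x hxD
    dsimp only at *
    by_cases ha : a ∈ p.support
    · obtain ⟨y, l, hya, r, rfl, hy⟩ := exists_eq_append_cons_of_mem_support ha hadj.ne'
      have hyD : y ∈ D.erase x :=
        hy ▸ Finset.mem_erase.2 ⟨hP.penultimate_takeUntil_ne hadj.ne hx ha, hPD ha⟩
      obtain ⟨M₁, hedges₁, hends₁, hend⟩ := exists_rotation hP hadj.symm hx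
      obtain ⟨M', hedges, hends⟩ := ih (D.erase x) (Finset.erase_ssubset hxD) hyD hya.symm
        (hedges₁ ▸ hM) fun v hv =>
          hend D v (Finset.ne_of_mem_erase hv) (hD v (Finset.mem_of_mem_erase hv))
      refine ⟨M', hedges.trans hedges₁, (Multiset.cons_inj_right y).1 ?_⟩
      rw [Multiset.cons_swap, hends, Multiset.cons_swap, hends₁, Multiset.cons_swap]
    · exact exists_insert_edge_of_notMem_support hP hadj ha

end Exchange

theorem exists_insert_edge {M : Multiset (BundledPath G)} (hadj : G.Adj a x)
    (hM : (s(a, x) ::ₘ M.bind edges).Nodup)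
    (hends : ∀ v, s(a, v) ∈ s(a, x) ::ₘ M.bind edges → v ∈ M.bind ends) :
    ∃ M' : Multiset (BundledPath G), M'.bind edges = s(a, x) ::ₘ M.bind edges ∧
      x ::ₘ M'.bind ends = a ::ₘ M.bind ends := by
  classical
  let D := {v ∈ (M.bind ends).toFinset | s(a, v) ∈ s(a, x) ::ₘ M.bind edges}
  have mem_D {v} (hv : s(a, v) ∈ s(a, x) ::ₘ M.bind edges) : v ∈ D :=
    Finset.mem_filter.2 ⟨Multiset.mem_toFinset.2 (hends v hv), hv⟩
  refine exists_insert_edge_of_hasEnd (mem_D (Multiset.mem_cons_self _ _)) hadj hM fun v hv => ?_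
  obtain ⟨hv, hav⟩ := Finset.mem_filter.1 hv
  obtain ⟨⟨v, b, p, hp⟩, hP, rfl⟩ := exists_memUpToReverse (Multiset.mem_toFinset.1 hv)
  refine ⟨_, hP, rfl, fun ha => mem_D ?_⟩
  obtain rfl | hva := eq_or_ne v a
  · simpa using hav
  · exact Multiset.mem_cons_of_mem
      (Multiset.mem_of_le hP.edges_le (mk_penultimate_takeUntil_mem_edges ha hva))

end BundledPath

section CoversOnceOrTwice

open BundledPath

variable {V : Type*} [DecidableEq V] {G : SimpleGraph V}

/-- Every element occurs in `S` exactly once or twice. -/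
def CoversOnceOrTwice (S : Multiset V) : Prop :=
  ∀ v, S.count v ∈ Set.Icc 1 2

/-- The edge `s(a, c)` carries the deficit of one path end from `a` to `c`. -/
lemma exists_coversOnceOrTwice_cons_of_erase {E : Finset (Sym2 V)}
    (hE : (E : Set (Sym2 V)) ⊆ G.edgeSet) {c : V} (hac : s(a, c) ∈ E) {M : Multiset (BundledPath G)}
    (hM : M.bind edges = (E.erase s(a, c)).val) (hends : CoversOnceOrTwice (a ::ₘ M.bind ends)) :
    ∃ M' : Multiset (BundledPath G), M'.bind edges = E.val ∧
      CoversOnceOrTwice (c ::ₘ M'.bind ends) := by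
  have hcons : s(a, c) ::ₘ M.bind edges = E.val := by
    rw [hM, Finset.erase_val, Multiset.cons_erase hac]
  obtain ⟨M', hM', hends'⟩ := exists_insert_edge (hE hac) (hcons ▸ E.nodup) fun v hv => by
    have hva : v ≠ a := (G.ne_of_adj (hE (by rwa [hcons] at hv))).symm
    have := (hends v).1
    rwa [Multiset.count_cons_of_ne hva, Multiset.one_le_count_iff_mem] at this
  exact ⟨M', hM'.trans hcons, hends' ▸ hends⟩

lemma exists_coversOnceOrTwice_of_cons {c : V} {M : Multiset (BundledPath G)}
    (hends : CoversOnceOrTwice (c ::ₘ M.bind ends)) :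
    ∃ M' : Multiset (BundledPath G), M'.bind edges = M.bind edges ∧
      CoversOnceOrTwice (M'.bind ends) := by
  by_cases hc : c ∈ M.bind ends
  · refine ⟨M, rfl, fun v => ⟨?_, (Multiset.count_le_count_cons v c _).trans (hends v).2⟩⟩
    obtain rfl | hvc := eq_or_ne v c
    · exact Multiset.one_le_count_iff_mem.2 hc
    · simpa [Multiset.count_cons_of_ne hvc] using (hends v).1
  · refine ⟨⟨c, c, .nil, .nil⟩ ::ₘ M, by simp [edges], fun v => ?_⟩
    have := hends v
    obtain rfl | hvc := eq_or_ne v c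
    · simp [ends, Multiset.count_eq_zero_of_notMem hc]
    · simpa [ends, Multiset.count_cons_of_ne hvc] using this

lemma exists_coversOnceOrTwice_cons_of_notMem {c : V} {M : Multiset (BundledPath G)}
    (hc : ∀ e ∈ M.bind edges, c ∉ e) (hends : CoversOnceOrTwice (M.bind ends)) :
    ∃ M' : Multiset (BundledPath G), M'.bind edges = M.bind edges ∧
      CoversOnceOrTwice (c ::ₘ M'.bind ends) := by
  obtain ⟨⟨c, b, p, hp⟩, hP, rfl⟩ :=
    exists_memUpToReverse (Multiset.one_le_count_iff_mem.1 (hends c).1)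
  obtain ⟨N, hMN, hMN', -⟩ := hP.exists_cons
  cases p with
  | nil =>
    refine ⟨N, by simp [hMN, edges], fun v => ?_⟩
    have := hends v
    obtain rfl | hvc := eq_or_ne v c
    · simp only [hMN', Multiset.cons_bind, ends, Multiset.insert_eq_cons, Multiset.cons_add,
        Multiset.singleton_add, Multiset.count_cons_self, Set.mem_Icc] at this ⊢
      lia
    · simpa [hMN', ends, Multiset.count_cons_of_ne hvc] using this
  | @cons _ d _ h q =>
    exact absurd (Sym2.mem_mk_left c d) (hc _ (Multiset.mem_of_le hP.edges_le
      (Multiset.mem_coe.2 (Walk.edges_cons h q ▸ List.mem_cons_self))))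

theorem exists_coversOnceOrTwice [Finite V] {E : Finset (Sym2 V)}
    (hE : (E : Set (Sym2 V)) ⊆ G.edgeSet) :
    (∃ M : Multiset (BundledPath G), M.bind edges = E.val ∧ CoversOnceOrTwice (M.bind ends)) ∧
    ∀ c, ∃ M : Multiset (BundledPath G), M.bind edges = E.val ∧
      CoversOnceOrTwice (c ::ₘ M.bind ends) := by
  cases nonempty_fintype V
  induction E using Finset.strongInduction with
  | H E ih =>
    have of_mem {a c} (hac : s(a, c) ∈ E) : ∃ M : Multiset (BundledPath G),
        M.bind edges = E.val ∧ CoversOnceOrTwice (c ::ₘ M.bind ends) := by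
      obtain ⟨M, hM, hends⟩ := (ih _ (Finset.erase_ssubset hac)
        (subset_trans (by simp) hE)).2 a
      exact exists_coversOnceOrTwice_cons_of_erase hE hac hM hends
    have hex : ∃ M : Multiset (BundledPath G),
        M.bind edges = E.val ∧ CoversOnceOrTwice (M.bind ends) := by
      obtain rfl | ⟨⟨a, c⟩, hac⟩ := E.eq_empty_or_nonempty
      · refine ⟨Finset.univ.val.map fun v => ⟨v, v, .nil, .nil⟩, ?_, fun v => ?_⟩
        · simp [Multiset.bind_map, edges]
        · have hsingle := Multiset.bind_singleton (Finset.univ : Finset V).val id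
          simp only [id, Multiset.map_id'] at hsingle
          simp [Multiset.bind_map, ends, Multiset.bind_cons, hsingle]
      · obtain ⟨M, hM, hends⟩ := of_mem hac
        obtain ⟨M', hM', hends'⟩ := exists_coversOnceOrTwice_of_cons hends
        exact ⟨M', hM'.trans hM, hends'⟩
    refine ⟨hex, fun c => ?_⟩
    by_cases hc : ∃ a, s(a, c) ∈ E
    · exact of_mem hc.choose_spec
    · obtain ⟨M, hM, hends⟩ := hex
      obtain ⟨M', hM', hends'⟩ := exists_coversOnceOrTwice_cons_of_notMem (c := c)
        (fun e he hce => hc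
          ⟨_, by rwa [Sym2.eq_swap, Sym2.other_spec hce, ← Finset.mem_val, ← hM]⟩) hends
      exact ⟨M', hM'.trans hM, hends'⟩

end CoversOnceOrTwice

section Parity

open BundledPath

variable {V : Type*} {G : SimpleGraph V}

lemma even_count_ends_iff [DecidableEq V] (P : BundledPath G) (v : V) :
    Even (P.ends.count v) ↔ Even (P.edges.countP (v ∈ ·)) := by
  rw [edges, Multiset.coe_countP, P.isPath.isTrail.even_countP_edges_iff]
  simp only [ends, Multiset.insert_eq_cons, Multiset.count_cons, Multiset.count_singleton]
  split_ifs <;> simp_all [eq_comm]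

lemma even_count_bind_ends_iff [DecidableEq V] (M : Multiset (BundledPath G)) (v : V) :
    Even ((M.bind ends).count v) ↔ Even ((M.bind edges).countP (v ∈ ·)) := by
  induction M using Multiset.induction_on with
  | empty => simp
  | cons P M ih =>
    simp only [Multiset.cons_bind, Multiset.count_add, Multiset.countP_add, Nat.even_add, ih,
      even_count_ends_iff]

lemma card_bind_ends (M : Multiset (BundledPath G)) :
    (M.bind ends).card = 2 * M.card := by
  simp [Multiset.card_bind, Function.comp_def, ends, mul_comm]

theorem exists_bind_ends_eq_univ [Fintype V] [DecidableRel G.Adj]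
    (hodd : ∀ v, Odd (G.degree v)) :
    ∃ M : Multiset (BundledPath G), M.bind edges = G.edgeFinset.val ∧
      M.bind ends = Finset.univ.val := by
  classical
  obtain ⟨M, hM, hends⟩ := (exists_coversOnceOrTwice (G.coe_edgeFinset.subset)).1
  refine ⟨M, hM, Multiset.ext.2 fun v => ?_⟩
  have hdeg : (M.bind edges).countP (v ∈ ·) = G.degree v := by
    rw [hM, ← G.card_incidenceFinset_eq_degree, G.incidenceFinset_eq_filter, Finset.card_def,
      Finset.filter_val, Multiset.countP_eq_card_filter]
  have hcount : Odd ((M.bind ends).count v) := by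
    rw [← Nat.not_even_iff_odd, even_count_bind_ends_iff, hdeg, Nat.not_even_iff_odd]
    exact hodd v
  obtain ⟨k, hk⟩ := hcount
  have := hends v
  simp only [Set.mem_Icc, Multiset.count_univ] at this ⊢
  lia

end Parity

section Hall

lemma exists_injective_forall_mem_of_sum_count_le {ι α : Type*} [Fintype ι] [DecidableEq α]
    {s : ι → Multiset α} {k : ℕ} (hk : 0 < k) (hs : ∀ i, k ≤ (s i).card)
    (hcount : ∀ a, ∑ i, (s i).count a ≤ k) :
    ∃ g : ι → α, Function.Injective g ∧ ∀ i, g i ∈ s i := by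
  have hall : ∀ A : Finset ι, A.card ≤ (A.biUnion fun i => (s i).toFinset).card := by
    intro A
    refine Nat.le_of_mul_le_mul_right ?_ hk
    calc A.card * k ≤ ∑ i ∈ A, (s i).card := by
          rw [← smul_eq_mul]; exact Finset.card_nsmul_le_sum _ _ _ fun i _ => hs i
      _ = ∑ i ∈ A, ∑ a ∈ A.biUnion fun i => (s i).toFinset, (s i).count a :=
          Finset.sum_congr rfl fun i hi => (Multiset.sum_count_eq_card fun a ha =>
            Finset.mem_biUnion.2 ⟨i, hi, Multiset.mem_toFinset.2 ha⟩).symm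
      _ = ∑ a ∈ A.biUnion fun i => (s i).toFinset, ∑ i ∈ A, (s i).count a := Finset.sum_comm
      _ ≤ (A.biUnion fun i => (s i).toFinset).card * k := by
          rw [← smul_eq_mul]
          exact Finset.sum_le_card_nsmul _ _ _ fun a _ =>
            (Finset.sum_le_sum_of_subset A.subset_univ).trans (hcount a)
  obtain ⟨g, hg, hmem⟩ := (Finset.all_card_le_biUnion_card_iff_exists_injective _).1 hall
  exact ⟨g, hg, fun i => Multiset.mem_toFinset.1 (hmem i)⟩

lemma sum_coe_eq_sum_map {α β : Type*} [DecidableEq α] [AddCommMonoid β] (s : Multiset α)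
    (f : α → β) : ∑ a : s, f a = (s.map f).sum :=
  congrArg Multiset.sum (s.map_univ f)

open BundledPath

variable {V : Type*} {G : SimpleGraph V}

theorem exists_rooted_paths [Fintype V] {E : Finset (Sym2 V)}
    (hE : (E : Set (Sym2 V)) ⊆ G.edgeSet) :
    ∃ R : V → BundledPath G, (∀ v, (R v).fst = v) ∧
      Finset.univ.val.bind (fun v => (R v).edges) = E.val := by
  classical
  obtain ⟨M, hM, hends⟩ := (exists_coversOnceOrTwice hE).1
  obtain ⟨g, hg, hmem⟩ : ∃ g : M → V, Function.Injective g ∧ ∀ P : M, g P ∈ P.1.ends :=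
    exists_injective_forall_mem_of_sum_count_le two_pos (fun P => by simp [ends]) fun v => by
      rw [sum_coe_eq_sum_map M fun P => P.ends.count v, ← Multiset.count_bind]
      exact (hends v).2
  have horient (P : M) : ∃ Q : BundledPath G, Q.fst = g P ∧ Q.edges = P.1.edges := by
    rcases mem_ends.1 (hmem P) with h | h
    · exact ⟨P, h.symm, rfl⟩
    · exact ⟨reverse P, h.symm, edges_reverse _⟩
  choose Q hQ hQedges using horient
  let R : V → BundledPath G := Function.extend g Q fun v => ⟨v, v, .nil, .nil⟩
  have hRg (P : M) : R (g P) = Q P := hg.extend_apply ..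
  have hR_trivial (v : V) (hv : v ∉ Set.range g) : R v = ⟨v, v, .nil, .nil⟩ :=
    Function.extend_apply' _ _ _ hv
  refine ⟨R, fun v => ?_, ?_⟩
  · by_cases hv : v ∈ Set.range g
    · obtain ⟨P, rfl⟩ := hv
      rw [hRg, hQ]
    · rw [hR_trivial v hv]
  · calc ∑ v, (R v).edges = ∑ P : M, P.1.edges :=
          (Fintype.sum_of_injective g hg _ _ (fun v hv => by rw [hR_trivial v hv]; rfl)
            fun P => by rw [hRg, hQedges]).symm
      _ = M.bind edges := sum_coe_eq_sum_map M edges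
      _ = E.val := hM

end Hall

section BoxProd

open BundledPath

variable {V W : Type*} {G : SimpleGraph V} {H : SimpleGraph W}

lemma edges_boxProdLeft {u u' : V} (p : G.Walk u u') (v : W) :
    (p.boxProdLeft H v).edges = p.edges.map (Sym2.map (·, v)) :=
  Walk.edges_map _ _

lemma edges_boxProdRight {v v' : W} (p : H.Walk v v') (u : V) :
    (p.boxProdRight G u).edges = p.edges.map (Sym2.map (Prod.mk u)) :=
  Walk.edges_map _ _

lemma mem_support_boxProdLeft {u u' : V} {p : G.Walk u u'} {v : W} {z : V × W} :
    z ∈ (p.boxProdLeft H v).support ↔ z.1 ∈ p.support ∧ z.2 = v := by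
  have h : (p.boxProdLeft H v).support = p.support.map (·, v) := Walk.support_map ..
  rw [h, List.mem_map]
  aesop

lemma mem_support_boxProdRight {v v' : W} {p : H.Walk v v'} {u : V} {z : V × W} :
    z ∈ (p.boxProdRight G u).support ↔ z.1 = u ∧ z.2 ∈ p.support := by
  have h : (p.boxProdRight G u).support = p.support.map (Prod.mk u) := Walk.support_map ..
  rw [h, List.mem_map]
  aesop

namespace BundledPath

/-- The copy of `P` in the layer `G □ {R.fst}`, prolonged at both ends by the copy of `R` starting
there. -/
def boxProd (P : BundledPath G) (hP : P.fst ≠ P.snd) (R : BundledPath H) :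
    BundledPath (G.boxProd H) where
  fst := (P.fst, R.snd)
  snd := (P.snd, R.snd)
  walk := (R.walk.boxProdRight G P.fst).reverse.append
    ((P.walk.boxProdLeft H R.fst).append (R.walk.boxProdRight G P.snd))
  isPath := by
    have hPl : (P.walk.boxProdLeft H R.fst).IsPath :=
      P.isPath.map (G.boxProdLeft H R.fst).injective
    have hRr (u : V) : (R.walk.boxProdRight G u).IsPath :=
      R.isPath.map (G.boxProdRight H u).injective
    refine isPath_append (hRr _).reverse (isPath_append hPl (hRr _) ?_) ?_
    · intro z hz hz'
      exact Prod.ext (mem_support_boxProdRight.1 hz').1 (mem_support_boxProdLeft.1 hz).2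
    · intro z hz hz'
      rw [Walk.support_reverse, List.mem_reverse, mem_support_boxProdRight] at hz
      rw [Walk.mem_support_append_iff, mem_support_boxProdLeft, mem_support_boxProdRight] at hz'
      exact Prod.ext hz.1 (hz'.resolve_right fun h => hP (hz.1.symm.trans h.1)).2

lemma edges_boxProd (P : BundledPath G) (hP : P.fst ≠ P.snd) (R : BundledPath H) :
    (P.boxProd hP R).edges = P.edges.map (Sym2.map (·, R.fst)) +
      P.ends.bind fun u => R.edges.map (Sym2.map (Prod.mk u)) := by
  simp only [boxProd, edges, ends, Walk.edges_append, Walk.edges_reverse, edges_boxProdLeft,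
    edges_boxProdRight, ← Multiset.coe_add, Multiset.coe_reverse, Multiset.insert_eq_cons,
    Multiset.cons_bind, Multiset.singleton_bind, Multiset.map_coe]
  exact add_left_comm ..

end BundledPath

lemma nodup_bind_map_sym2Map {ι α β : Type*} [Fintype ι] {f : ι → α → β}
    (hf : Function.Injective2 f) (E : Finset (Sym2 α)) :
    (Finset.univ.val.bind fun i => E.val.map (Sym2.map (f i))).Nodup := by
  refine Multiset.nodup_bind.2 ⟨fun i _ => E.nodup.map (Sym2.map.injective (hf.right i)),
    Finset.univ.nodup.pairwise fun i _ j _ hij => Multiset.disjoint_left.2 ?_⟩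
  intro e hi hj
  obtain ⟨⟨x, y⟩, -, rfl⟩ := Multiset.mem_map.1 hi
  obtain ⟨e', -, he'⟩ := Multiset.mem_map.1 hj
  have hx : f i x ∈ Sym2.map (f j) e' := by
    rw [he']
    exact Sym2.mem_mk_left _ _
  obtain ⟨z, -, hz⟩ := Sym2.mem_map.1 hx
  exact hij (hf hz).1.symm

lemma mem_bind_map_mk_left_iff [Fintype W] [Fintype G.edgeSet] {a a' : V} {b b' : W} :
    s((a, b), (a', b')) ∈
      Finset.univ.val.bind (fun v : W => G.edgeFinset.val.map (Sym2.map (·, v))) ↔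
        G.Adj a a' ∧ b = b' := by
  simp only [Multiset.mem_bind, Multiset.mem_map, Finset.mem_val, Finset.mem_univ, true_and,
    mem_edgeFinset, Sym2.exists, mem_edgeSet, Sym2.map_mk, Sym2.eq_iff, Prod.mk.injEq]
  constructor
  · rintro ⟨_, _, _, h, ⟨⟨rfl, rfl⟩, rfl, rfl⟩ | ⟨⟨rfl, rfl⟩, rfl, rfl⟩⟩
    exacts [⟨h, rfl⟩, ⟨h.symm, rfl⟩]
  · rintro ⟨h, rfl⟩
    exact ⟨_, _, _, h, .inl ⟨⟨rfl, rfl⟩, rfl, rfl⟩⟩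

lemma mem_bind_map_mk_right_iff [Fintype V] [Fintype H.edgeSet] {a a' : V} {b b' : W} :
    s((a, b), (a', b')) ∈
      Finset.univ.val.bind (fun u : V => H.edgeFinset.val.map (Sym2.map (Prod.mk u))) ↔
        H.Adj b b' ∧ a = a' := by
  simp only [Multiset.mem_bind, Multiset.mem_map, Finset.mem_val, Finset.mem_univ, true_and,
    mem_edgeFinset, Sym2.exists, mem_edgeSet, Sym2.map_mk, Sym2.eq_iff, Prod.mk.injEq]
  constructor
  · rintro ⟨_, _, _, h, ⟨⟨rfl, rfl⟩, rfl, rfl⟩ | ⟨⟨rfl, rfl⟩, rfl, rfl⟩⟩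
    exacts [⟨h, rfl⟩, ⟨h.symm, rfl⟩]
  · rintro ⟨h, rfl⟩
    exact ⟨_, _, _, h, .inl ⟨⟨rfl, rfl⟩, rfl, rfl⟩⟩

lemma edgeFinset_boxProd_val [Fintype V] [Fintype W] [Fintype G.edgeSet] [Fintype H.edgeSet]
    [Fintype (G.boxProd H).edgeSet] :
    (G.boxProd H).edgeFinset.val =
      (Finset.univ.val.bind fun v => G.edgeFinset.val.map (Sym2.map (·, v))) +
      Finset.univ.val.bind fun u => H.edgeFinset.val.map (Sym2.map (Prod.mk u)) := by
  refine (Multiset.Nodup.ext (Finset.nodup _) (Multiset.nodup_add.2 ⟨?_, ?_, ?_⟩)).2 ?_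
  · exact nodup_bind_map_sym2Map (f := fun v u => (u, v)) (fun _ _ _ _ h => by simp_all) _
  · exact nodup_bind_map_sym2Map (f := Prod.mk) (fun _ _ _ _ h => by simp_all) _
  · rw [Multiset.disjoint_left]
    rintro ⟨⟨a, b⟩, ⟨a', b'⟩⟩ hl hr
    exact (mem_bind_map_mk_left_iff.1 hl).1.ne (mem_bind_map_mk_right_iff.1 hr).2
  · rintro ⟨⟨a, b⟩, ⟨a', b'⟩⟩
    rw [Multiset.mem_add]
    exact mem_edgeFinset.trans (boxProd_adj.trans
      (or_congr mem_bind_map_mk_left_iff.symm mem_bind_map_mk_right_iff.symm))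

theorem pathNumber_le_card [Fintype G.edgeSet] {M : Multiset (BundledPath G)}
    (hM : M.bind edges = G.edgeFinset.val) : G.pathNumber ≤ M.card := by
  classical
  let f (P : BundledPath G) : G.Subgraph := P.walk.toSubgraph
  have mem_f {P : BundledPath G} {e : Sym2 V} : e ∈ (f P).edgeSet ↔ e ∈ P.edges :=
    P.walk.mem_edges_toSubgraph
  refine le_trans (Nat.sInf_le ⟨(M.map f).toFinset, ⟨?_, ?_, ?_⟩, rfl⟩)
    ((Multiset.toFinset_card_le _).trans (Multiset.card_map f M).le)
  · intro S hS
    obtain ⟨P, -, rfl⟩ := Multiset.mem_map.1 (Multiset.mem_toFinset.1 hS)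
    exact ⟨_, _, P.walk, P.isPath, rfl⟩
  · intro S hS T hT hne
    obtain ⟨P, hP, rfl⟩ := Multiset.mem_map.1 (Multiset.mem_toFinset.1 hS)
    obtain ⟨Q, hQ, rfl⟩ := Multiset.mem_map.1 (Multiset.mem_toFinset.1 hT)
    obtain ⟨N, rfl⟩ := Multiset.exists_cons_of_mem hP
    have hQN : Q ∈ N := (Multiset.mem_cons.1 hQ).resolve_left fun h => hne (h ▸ rfl)
    have hnodup : (P.edges + N.bind edges).Nodup := by
      rw [← Multiset.cons_bind, hM]
      exact G.edgeFinset.nodup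
    exact Set.disjoint_left.2 fun e he he' => Multiset.disjoint_left.1
      (Multiset.nodup_add.1 hnodup).2.2 (mem_f.1 he) (Multiset.mem_bind.2 ⟨Q, hQN, mem_f.1 he'⟩)
  · intro e he
    obtain ⟨P, hP, heP⟩ := Multiset.mem_bind.1 (hM ▸ mem_edgeFinset.2 he : e ∈ M.bind edges)
    exact ⟨f P, Multiset.mem_toFinset.2 (Multiset.mem_map_of_mem f hP), mem_f.2 heP⟩

theorem pathNumber_boxProd_le [Fintype V] [Fintype W] [Fintype G.edgeSet]
    {M : Multiset (BundledPath G)} (hM : M.bind edges = G.edgeFinset.val)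
    (hends : M.bind ends = Finset.univ.val) :
    (G.boxProd H).pathNumber ≤ M.card * Fintype.card W := by
  classical
  have hne (P) (hP : P ∈ M) : P.fst ≠ P.snd := by
    have : P.ends.Nodup :=
      Multiset.nodup_of_le (Multiset.le_bind M hP) (hends ▸ Finset.univ.nodup)
    simpa [ends] using this
  obtain ⟨R, hR, hRedges⟩ := exists_rooted_paths (G := H) H.coe_edgeFinset.subset
  let S : Multiset (BundledPath G × W) := M ×ˢ Finset.univ.val
  let T : Multiset (BundledPath (G.boxProd H)) :=
    S.attach.map fun x => x.1.1.boxProd (hne _ (Multiset.mem_product.1 x.2).1) (R x.1.2)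
  have hT : T.bind edges = (G.boxProd H).edgeFinset.val := by
    calc T.bind edges
        = S.bind fun x => x.1.edges.map (Sym2.map (·, x.2)) +
            x.1.ends.bind fun u => (R x.2).edges.map (Sym2.map (Prod.mk u)) := by
          simp only [T, Multiset.bind_map, edges_boxProd, hR]
          exact S.attach_bind_coe fun x => x.1.edges.map (Sym2.map (·, x.2)) +
            x.1.ends.bind fun u => (R x.2).edges.map (Sym2.map (Prod.mk u))
      _ = (Finset.univ.val.bind fun v => (M.bind edges).map (Sym2.map (·, v))) +
            (M.bind ends).bind fun u =>
              (Finset.univ.val.bind fun v => (R v).edges).map (Sym2.map (Prod.mk u)) := by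
          simp only [S, SProd.sprod, Multiset.product, Multiset.bind_assoc, Multiset.bind_map,
            Multiset.map_bind, Multiset.bind_add]
          rw [Multiset.bind_bind]
          congr 2
          funext P
          exact Multiset.bind_bind ..
      _ = (G.boxProd H).edgeFinset.val := by
          rw [hM, hends, hRedges, edgeFinset_boxProd_val]
  calc (G.boxProd H).pathNumber ≤ T.card := pathNumber_le_card hT
    _ = M.card * Fintype.card W := by simp [T, S, Multiset.card_product]

end BoxProd

theorem corollary4p3_general {V W : Type*} [Fintype V] [Fintype W]
    (G : SimpleGraph V) [DecidableRel G.Adj] (H : SimpleGraph W)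
    (hodd : ∀ v : V, Odd (G.degree v)) :
    ((G.boxProd H).pathNumber : ℚ) ≤ Fintype.card V * Fintype.card W / 2 := by
  obtain ⟨M, hM, hends⟩ := exists_bind_ends_eq_univ hodd
  have hcard : Fintype.card V = 2 * M.card := by
    rw [← card_bind_ends, hends]
    rfl
  calc ((G.boxProd H).pathNumber : ℚ) ≤ M.card * Fintype.card W :=
        mod_cast pathNumber_boxProd_le hM hends
    _ = Fintype.card V * Fintype.card W / 2 := by
        rw [hcard]
        push_cast
        ring

theorem corollary4p3 {V W : Type*} [Fintype V] [Fintype W]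
    (G : SimpleGraph V) [DecidableRel G.Adj] (H : SimpleGraph W) (m n : ℕ)
    (hm : Fintype.card V = m) (hm2 : 2 ≤ m) (hn : Fintype.card W = n)
    (hG : G.Connected) (hodd : ∀ v : V, Odd (G.degree v)) (hH : H.Connected) :
    ((G.boxProd H).pathNumber : ℚ) ≤ (m : ℚ) * (n : ℚ) / 2 := by
  rw [← hm, ← hn]
  exact corollary4p3_general G H hodd
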